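/- **Definitions.** Let $M$ be an $n\times n$ matrix over any alphabet, $n\ge 1$. For $1\le b\le n$ let $d_{b\times b}(M)$ be the number of distinct $b\times b$ submatrices (of consecutive rows and columns) of $M$, and let $\delta_{2D}=\delta_{2D}(M)=\max\{d_{b\times b}(M)/b^2 : 1\le b\le n\}$. Note that $1\le\delta_{2D}\le n^2$. Fix an integer $k\ge 2$ and a word size of $w=w(n)$ bits, where $w(n)=\Theta(\log n)$ and a word can hold any integer in $[0,n]$. The two-dimensional block tree (2D-BT) of $M$ is built as follows. Let $k^\alpha$ be the largest power of $k$ with $k^\alpha\le n/\sqrt{\delta_{2D}}$. The root represents $M$, and its children, the nodes of level $0$, are the blocks of the grid of side $k^\alpha$ on $M$ (blocks are cut off at the lower and right border if $k^\alpha\nmid n$). The nodes of level $\ell$ are blocks of the grid of side $b=k^{\alpha-\ell}$. A block of side $b$ is *marked* if it intersects the first occurrence, in row major order, of some $b\times b$ submatrix of $M$. A marked node is split into its (at most) $k^2$ blocks of side $b/k$, which are its children in the next level. An unmarked node is a leaf; it stores references to the (up to four) marked blocks that overlap the first occurrence of its content, and the offset of that occurrence. The splitting ends at the first level at which storing a block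 explicitly, with $b^2\lceil\log_2\sigma\rceil$ bits where $\sigma$ is the number of symbols in $M$, takes no more bits than such a leaf; the nodes of that level store their blocks explicitly. Space is the total number of words stored: $O(1)$ for a leaf and $O(k^2)$ for a marked internal node, plus one reference at the root for each node of level $0$. **Theorem.** 1. For every fixed $k$ and $w(\cdot)$ there is a constant $C$ such that for every $n\ge1$ and every $n\times n$ matrix over any alphabet the 2D-BT uses at most $$C\,\bigl(\delta_{2D}+\sqrt{n\,\delta_{2D}}\bigr)\Bigl(1+\log\frac{n}{\sqrt{\delta_{2D}}}\Bigr)$$ words. 2. For every fixed $k$, $w(\cdot)$ and $\varepsilon>0$ there is a constant $C$ such that for every $n\ge 2$ and every $n\times n$ matrix over any alphabet with $\delta_{2D}\le n^{1-\varepsilon}$ the 2D-BT uses at most $$C\,\bigl(\delta_{2D}+\sqrt{n\,\delta_{2D}}\bigr)\log\frac{n}{\delta_{2D}}$$ words. 3. This space is optimal within a multiplicative factor $O(\log n)$ in the following sense. There are constants $D$ and $c>0$ and sets $\mathcal F_n$ of $n\times n$ matrices over an alphabet of three symbols such that $\delta_{2D}(M)\le D$ for all $n$ and $M\in\mathcal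 F_n$, and for every $n\ge 2$: * for every injective code $\mathcal C:\mathcal F_n\to\{0,1\}^*$ there is $W\in\mathcal F_n$ with $|\mathcal C(W)|\ge c\sqrt n\,\log n$ bits; * for every fixed $k$ and $w(\cdot)$ there is a constant $C$, independent of $n$, such that the 2D-BT of every $M\in\mathcal F_n$ takes at most $C\sqrt n\,\log^2 n$ bits (the number of words times $w(n)$); moreover, for every injective code $\mathcal C:\mathcal F_n\to\{0,1\}^*$ there is $W\in\mathcal F_n$ such that the 2D-BT of every $M\in\mathcal F_n$ takes at most $C\log n\cdot|\mathcal C(W)|$ bits. -/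

import Mathlib

open Asymptotics Filter

universe u

namespace TwoDBlockTree

variable {S : Type u} {n : ℕ}

/-- The `b × b` submatrix of `M` whose topmost left cell is `(r, c)` (cells are numbered from 0). -/
def window (M : Matrix (Fin n) (Fin n) S) (b r c : ℕ) (hr : r + b ≤ n) (hc : c + b ≤ n) :
    Matrix (Fin b) (Fin b) S :=
  M.submatrix (fun i => ⟨r + i, by have := i.isLt; omega⟩)
    (fun j => ⟨c + j, by have := j.isLt; omega⟩)

/-- The number of distinct `b × b` submatrices of `M`. -/
noncomputable def distinctCount (M : Matrix (Fin n) (Fin n) S) (b : ℕ) : ℕ :=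
  {W : Matrix (Fin b) (Fin b) S |
    ∃ (r c : ℕ) (hr : r + b ≤ n) (hc : c + b ≤ n), W = window M b r c hr hc}.ncard

/-- The measure `δ_2D(M)`: the maximum over `b ∈ [1, n]` of (number of distinct `b × b`
submatrices) divided by `b ^ 2`. -/
noncomputable def delta2D (M : Matrix (Fin n) (Fin n) S) : ℝ :=
  ((Finset.Icc 1 n).sup
    (fun b : ℕ => (distinctCount M b : NNReal) / (b : NNReal) ^ 2) : NNReal)

/-- The number of symbols that appear in `M`. -/
noncomputable def alphabetSize (M : Matrix (Fin n) (Fin n) S) : ℕ :=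
  (Set.range (fun p : Fin n × Fin n => M p.1 p.2)).ncard

/-- The `b × b` submatrix of `M` starting at `(r, c)` is the first occurrence, in row major order,
of its content. -/
def IsFirstOcc (M : Matrix (Fin n) (Fin n) S) (b r c : ℕ) : Prop :=
  ∃ (hr : r + b ≤ n) (hc : c + b ≤ n), ∀ (r' c' : ℕ) (hr' : r' + b ≤ n) (hc' : c' + b ≤ n),
    window M b r' c' hr' hc' = window M b r c hr hc → r < r' ∨ (r = r' ∧ c ≤ c')

/-- The block `(I, J)` of side `b` consists of the cells of `M` in rows `I * b, …, I * b + b - 1`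
and columns `J * b, …, J * b + b - 1`. It is cut off at the lower and the right border of `M` if
`b` does not divide `n`. These are the indices of the (nonempty) blocks of side `b`. -/
def blocks (n b : ℕ) : Finset (ℕ × ℕ) :=
  (Finset.range n ×ˢ Finset.range n).filter (fun p => p.1 * b < n ∧ p.2 * b < n)

/-- The block `(I, J)` of side `b` is marked: it intersects the first occurrence, in row major
order, of some `b × b` submatrix of `M`. -/
def IsMarked (M : Matrix (Fin n) (Fin n) S) (b : ℕ) (p : ℕ × ℕ) : Prop :=
  ∃ r c : ℕ, IsFirstOcc M b r c ∧
    (r < (p.1 + 1) * b ∧ p.1 * b < r + b) ∧ (c < (p.2 + 1) * b ∧ p.2 * b < c + b)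

/-- The exponent `α` of the side `k ^ α` of the blocks into which the whole matrix is divided first:
`k ^ α` is the largest power of `k` that is at most `n / √δ_2D`. -/
noncomputable def topExp (M : Matrix (Fin n) (Fin n) S) (k : ℕ) : ℕ :=
  Nat.log k ⌊(n : ℝ) / Real.sqrt (delta2D M)⌋₊

open Classical in
/-- The nodes of the two-dimensional block tree below its root, level by level. The blocks at
level `l` have side `k ^ (topExp M k - l)`. Every block is a node at level `0`; a block at
level `l + 1` is a node if the block of level `l` that contains it is a marked node. -/
noncomputable def nodes (M : Matrix (Fin n) (Fin n) S) (k : ℕ) : ℕ → Finset (ℕ × ℕ)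
  | 0 => blocks n (k ^ topExp M k)
  | l + 1 => (blocks n (k ^ (topExp M k - (l + 1)))).filter (fun p =>
      (p.1 / k, p.2 / k) ∈ nodes M k l ∧ IsMarked M (k ^ (topExp M k - l)) (p.1 / k, p.2 / k))

/-- The number of words of a pointer leaf: references to the (up to) four marked blocks that overlap
the first occurrence, each given by its two block indices, and the two coordinates of the offset of
that first occurrence. (For a block that is cut off at a border, the occurrence is that of the full
square that contains the block and is flush with that border.) -/
def pointerLeafWords : ℕ := 4 * 2 + 2

/-- The number of words of `w` bits that hold a `b × b` block explicitly, symbol by symbol. -/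
noncomputable def explicitWords (M : Matrix (Fin n) (Fin n) S) (w b : ℕ) : ℕ :=
  (b ^ 2 * Nat.clog 2 (alphabetSize M)) ⌈/⌉ w

/-- The exponent of the side of the smallest blocks. The splitting ends at the first level at which
storing a block explicitly takes no more bits than a pointer leaf does (at single cells at the
latest). -/
noncomputable def bottomExp (M : Matrix (Fin n) (Fin n) S) (k w : ℕ) : ℕ :=
  Nat.findGreatest
    (fun e => (k ^ e) ^ 2 * Nat.clog 2 (alphabetSize M) ≤ pointerLeafWords * w) (topExp M k)

/-- The last level of the tree. -/
noncomputable def lastLevel (M : Matrix (Fin n) (Fin n) S) (k w : ℕ) : ℕ :=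
  topExp M k - bottomExp M k w

open Classical in
/-- The number of words stored at the node `p` of level `l`: one word for its kind, and its content.
A node of the last level stores its block explicitly. Above the last level, a marked node stores
`k ^ 2` references to its children, and an unmarked node is a pointer leaf. -/
noncomputable def nodeWords (M : Matrix (Fin n) (Fin n) S) (k w l : ℕ) (p : ℕ × ℕ) : ℕ :=
  1 + if l = lastLevel M k w then explicitWords M w (k ^ bottomExp M k w)
    else if IsMarked M (k ^ (topExp M k - l)) p then 2 * k ^ 2
    else pointerLeafWords

/-- The space, in words of `w` bits, of the two-dimensional block tree of `M` with arity parameter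
`k`: the root stores one reference for each node of level `0`; then come the nodes of all levels. -/
noncomputable def spaceWords (M : Matrix (Fin n) (Fin n) S) (k w : ℕ) : ℕ :=
  2 * (nodes M k 0).card +
    ∑ l ∈ Finset.range (lastLevel M k w + 1), ∑ p ∈ nodes M k l, nodeWords M k w l p

/-- `w n` is an admissible word size, in bits, for `n × n` matrices: a word holds every integer up to
`n`, and `w n = Θ(log n)`. -/
def IsWordSize (w : ℕ → ℕ) : Prop :=
  (∀ n, Nat.size n ≤ w n) ∧ (fun n => (w n : ℝ)) =Θ[atTop] (fun n : ℕ => Real.log n)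

end TwoDBlockTree

/-!
Every window of side `2 * b` that contains the first occurrence of a `b × b` submatrix is itself the
first occurrence of its content, so there are at most `4 * δ * b ^ 2` such windows. A first
occurrence that marks a block far from the border is contained in `b ^ 2` of them, while each of
them meets at most nine blocks, so `O(δ)` inner blocks are marked. Along the border, where only one
coordinate of the window is free to move, the same count gives `O(δ * b)`, and since only `O(n / b)`
blocks lie there, the geometric mean bounds the number of marked ones by `O(√(n * δ))`. Hence each
of the `O(1 + log (n / √δ))` levels has `O(δ + √(n * δ))` nodes of `O(1)` words.

For the lower bound, a single row with ones at pairwise distances of at least `⌊√n⌋` and zeros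
elsewhere has `δ ≤ 2`. Choosing one of about `√n` positions in each of about `√n / 2` slots yields
`2 ^ Ω(√n * log n)` such matrices, and an injective binary code must give one of them a code word of
length `Ω(√n * log n)`.
-/

namespace TwoDBlockTree

variable {S : Type u} {n : ℕ}

section DistinctWindows

/-- The set of the `b × b` submatrices of `M`, so that `distinctCount M b` is its cardinality. -/
def windowSet (M : Matrix (Fin n) (Fin n) S) (b : ℕ) : Set (Matrix (Fin b) (Fin b) S) :=
  {W | ∃ (r c : ℕ) (hr : r + b ≤ n) (hc : c + b ≤ n), W = window M b r c hr hc}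

lemma windowSet_eq_range (M : Matrix (Fin n) (Fin n) S) (b : ℕ) :
    windowSet M b = Set.range fun p : Fin (n + 1 - b) × Fin (n + 1 - b) =>
      window M b p.1 p.2 (by omega) (by omega) := by
  ext W
  constructor
  · rintro ⟨r, c, hr, hc, rfl⟩
    exact ⟨(⟨r, by omega⟩, ⟨c, by omega⟩), rfl⟩
  · rintro ⟨p, rfl⟩
    exact ⟨p.1, p.2, by omega, by omega, rfl⟩

lemma finite_windowSet (M : Matrix (Fin n) (Fin n) S) (b : ℕ) : (windowSet M b).Finite := by
  rw [windowSet_eq_range]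
  exact Set.finite_range _

lemma distinctCount_le_sq (M : Matrix (Fin n) (Fin n) S) (b : ℕ) :
    distinctCount M b ≤ (n + 1 - b) ^ 2 := by
  change (windowSet M b).ncard ≤ _
  rw [windowSet_eq_range, ← Nat.card_coe_set_eq]
  exact (Finite.card_range_le _).trans_eq (by simp [sq])

lemma distinctCount_pos (M : Matrix (Fin n) (Fin n) S) {b : ℕ} (hbn : b ≤ n) :
    0 < distinctCount M b :=
  (Set.ncard_pos (finite_windowSet M b)).2 ⟨_, 0, 0, by omega, by omega, rfl⟩

lemma delta2D_le (M : Matrix (Fin n) (Fin n) S) {D : ℝ} (hD : 0 ≤ D)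
    (h : ∀ b, 1 ≤ b → b ≤ n → (distinctCount M b : ℝ) ≤ D * (b : ℝ) ^ 2) :
    delta2D M ≤ D := by
  lift D to NNReal using hD
  refine NNReal.coe_le_coe.2 (Finset.sup_le fun b hb => ?_)
  obtain ⟨hb1, hbn⟩ := Finset.mem_Icc.1 hb
  exact div_le_of_le_mul₀ zero_le zero_le (by exact_mod_cast h b hb1 hbn)

lemma distinctCount_le_delta2D_mul (M : Matrix (Fin n) (Fin n) S) {b : ℕ} (hb : 1 ≤ b) :
    (distinctCount M b : ℝ) ≤ delta2D M * (b : ℝ) ^ 2 := by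
  rcases le_or_gt b n with hbn | hnb
  · have hratio : (distinctCount M b : NNReal) / (b : NNReal) ^ 2 ≤ (Finset.Icc 1 n).sup
        fun b : ℕ => (distinctCount M b : NNReal) / (b : NNReal) ^ 2 :=
      Finset.le_sup (f := fun b : ℕ => (distinctCount M b : NNReal) / (b : NNReal) ^ 2)
        (Finset.mem_Icc.2 ⟨hb, hbn⟩)
    rw [delta2D]
    exact_mod_cast (div_le_iff₀ (by positivity)).1 hratio
  · have hzero : distinctCount M b = 0 := by
      simpa [Nat.sub_eq_zero_of_le (Nat.succ_le_of_lt hnb)] using distinctCount_le_sq M b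
    rw [hzero, Nat.cast_zero]
    exact mul_nonneg (NNReal.coe_nonneg _) (sq_nonneg _)

lemma one_le_delta2D (M : Matrix (Fin n) (Fin n) S) (hn : 1 ≤ n) : 1 ≤ delta2D M :=
  calc (1 : ℝ) ≤ distinctCount M 1 := by exact_mod_cast distinctCount_pos M hn
    _ ≤ delta2D M * ((1 : ℕ) : ℝ) ^ 2 := distinctCount_le_delta2D_mul M le_rfl
    _ = delta2D M := by simp

lemma delta2D_le_sq (M : Matrix (Fin n) (Fin n) S) : delta2D M ≤ (n : ℝ) ^ 2 := by
  refine delta2D_le M (by positivity) fun b hb _ => ?_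
  calc (distinctCount M b : ℝ) ≤ (n : ℝ) ^ 2 := by
        exact_mod_cast (distinctCount_le_sq M b).trans (Nat.pow_le_pow_left (by omega) 2)
    _ ≤ (n : ℝ) ^ 2 * (b : ℝ) ^ 2 :=
        le_mul_of_one_le_right (by positivity) (one_le_pow₀ (by exact_mod_cast hb))

end DistinctWindows

section FirstOccurrences

lemma IsFirstOcc.eq_of_window_eq {M : Matrix (Fin n) (Fin n) S} {b r c r' c' : ℕ}
    (h : IsFirstOcc M b r c) (h' : IsFirstOcc M b r' c') {hr : r + b ≤ n} {hc : c + b ≤ n}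
    {hr' : r' + b ≤ n} {hc' : c' + b ≤ n} (e : window M b r c hr hc = window M b r' c' hr' hc') :
    r = r' ∧ c = c' := by
  obtain ⟨_, _, hmin⟩ := h
  obtain ⟨_, _, hmin'⟩ := h'
  have := hmin r' c' hr' hc' e.symm
  have := hmin' r c hr hc e
  omega

/- An earlier occurrence of the content of the large window would contain an earlier occurrence of
the content of the small one. -/
lemma IsFirstOcc.enlarge {M : Matrix (Fin n) (Fin n) S} {b r c B r' c' : ℕ}
    (h : IsFirstOcc M b r c) (hr : r' ≤ r) (hrb : r + b ≤ r' + B) (hrn : r' + B ≤ n)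
    (hc : c' ≤ c) (hcb : c + b ≤ c' + B) (hcn : c' + B ≤ n) : IsFirstOcc M B r' c' := by
  obtain ⟨_, _, hmin⟩ := h
  refine ⟨hrn, hcn, fun r₂ c₂ hr₂ hc₂ heq => ?_⟩
  have hle := hmin (r₂ + (r - r')) (c₂ + (c - c')) (by omega) (by omega) (by
    ext i j
    have hij := congr_fun₂ heq ⟨r - r' + i, by omega⟩ ⟨c - c' + j, by omega⟩
    simp only [window, Matrix.submatrix_apply] at hij ⊢
    convert hij using 3 <;> omega)
  omega

open Classical in
/-- The positions of the first occurrences of the `b × b` submatrices of `M`. -/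
noncomputable def firstOccs (M : Matrix (Fin n) (Fin n) S) (b : ℕ) : Finset (ℕ × ℕ) :=
  (Finset.range (n + 1) ×ˢ Finset.range (n + 1)).filter fun p => IsFirstOcc M b p.1 p.2

lemma mem_firstOccs {M : Matrix (Fin n) (Fin n) S} {b : ℕ} {p : ℕ × ℕ} :
    p ∈ firstOccs M b ↔ IsFirstOcc M b p.1 p.2 := by
  simp only [firstOccs, Finset.mem_filter, Finset.mem_product, Finset.mem_range,
    and_iff_right_iff_imp]
  rintro ⟨hr, hc, _⟩
  omega

lemma card_firstOccs_le (M : Matrix (Fin n) (Fin n) S) (b : ℕ) :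
    (firstOccs M b).card ≤ distinctCount M b := by
  classical
  change _ ≤ (windowSet M b).ncard
  rw [Set.ncard_eq_toFinset_card _ (finite_windowSet M b)]
  refine Finset.card_le_card_of_forall_subsingleton
    (fun p W => ∃ (hr : p.1 + b ≤ n) (hc : p.2 + b ≤ n), W = window M b p.1 p.2 hr hc) ?_ ?_
  · intro p hp
    obtain ⟨hr, hc, _⟩ := mem_firstOccs.1 hp
    exact ⟨_, (Set.Finite.mem_toFinset _).2 ⟨p.1, p.2, hr, hc, rfl⟩, hr, hc, rfl⟩
  · rintro W - p ⟨hp, hr, hc, rfl⟩ p' ⟨hp', hr', hc', e⟩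
    exact Prod.ext_iff.2 ((mem_firstOccs.1 hp).eq_of_window_eq (mem_firstOccs.1 hp') e)

lemma card_firstOccs_two_mul_le (M : Matrix (Fin n) (Fin n) S) {b : ℕ} (hb : 1 ≤ b) :
    ((firstOccs M (2 * b)).card : ℝ) ≤ 4 * delta2D M * (b : ℝ) ^ 2 :=
  calc ((firstOccs M (2 * b)).card : ℝ) ≤ distinctCount M (2 * b) := by
        exact_mod_cast card_firstOccs_le M (2 * b)
    _ ≤ delta2D M * ((2 * b : ℕ) : ℝ) ^ 2 := distinctCount_le_delta2D_mul M (by omega)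
    _ = 4 * delta2D M * (b : ℝ) ^ 2 := by push_cast; ring

end FirstOccurrences

section MarkedBlocks

/-- The block of side `b` with index `I` on the line, i.e. the interval `[I * b, (I + 1) * b)`,
meets the interval `[s, s + m)`. A block is marked if both of its indices meet, in this sense, the
sides of a common first occurrence. -/
def Meets (b I s m : ℕ) : Prop := s < (I + 1) * b ∧ I * b < s + m

lemma Meets.mono {b I s m s' m' : ℕ} (h : Meets b I s m) (hs : s' ≤ s) (hm : s + m ≤ s' + m') :
    Meets b I s' m' :=
  ⟨hs.trans_lt h.1, h.2.trans_le hm⟩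

lemma Meets.mem_Icc {b I s m : ℕ} (h : Meets b I s (m * b)) :
    I ∈ Finset.Icc (s / b) (s / b + m) := by
  have hb : 0 < b := Nat.pos_of_mul_pos_left (h.1.trans_le' s.zero_le)
  have hlow : s / b < I + 1 := (Nat.div_lt_iff_lt_mul hb).2 h.1
  have hup : I ≤ s / b + m := by
    rw [← Nat.add_mul_div_right s m hb]
    exact (Nat.le_div_iff_mul_le hb).2 h.2.le
  exact Finset.mem_Icc.2 ⟨Nat.lt_succ_iff.1 hlow, hup⟩

/-- The starts of the intervals of length `2 * b` in `[0, n)` that contain `[r, r + b)`. -/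
def coveringStarts (n b r : ℕ) : Finset ℕ :=
  (Finset.range (r + 1)).filter fun s => r ≤ s + b ∧ s + 2 * b ≤ n

lemma mem_coveringStarts {n b r s : ℕ} :
    s ∈ coveringStarts n b r ↔ s ≤ r ∧ r ≤ s + b ∧ s + 2 * b ≤ n := by
  rw [coveringStarts, Finset.mem_filter, Finset.mem_range, Nat.lt_succ_iff]

lemma coveringStarts_nonempty {n b r : ℕ} (hr : r + b ≤ n) (hb : 2 * b ≤ n) :
    (coveringStarts n b r).Nonempty :=
  ⟨min r (n - 2 * b), mem_coveringStarts.2 (by omega)⟩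

/-- The indices of the blocks of side `b` on the line `[0, n)` that are so far from both of its ends
that every interval of length `b` that they meet is contained in the largest possible number of
intervals of length `2 * b`. -/
def innerIndices (n b : ℕ) : Finset ℕ := Finset.Icc 2 (n / b - 3)

/-- The indices of the other blocks of side `b` on the line `[0, n)`. -/
def outerIndices (n b : ℕ) : Finset ℕ := Finset.range (n / b + 1) \ innerIndices n b

lemma card_innerIndices_le (n b : ℕ) : (innerIndices n b).card ≤ n / b := by
  rw [innerIndices, Nat.card_Icc]
  generalize n / b = m
  omega

lemma card_outerIndices_le (n b : ℕ) : (outerIndices n b).card ≤ 5 := by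
  have hsub : innerIndices n b ⊆ Finset.range (n / b + 1) := fun I hI => by
    rw [innerIndices, Finset.mem_Icc] at hI
    rw [Finset.mem_range]
    omega
  rw [outerIndices, Finset.card_sdiff_of_subset hsub, Finset.card_range, innerIndices,
    Nat.card_Icc]
  omega

lemma add_three_mul_le_of_mem_innerIndices {n b I : ℕ} (hI : I ∈ innerIndices n b) :
    2 ≤ I ∧ (I + 3) * b ≤ n := by
  obtain ⟨h2, h3⟩ := Finset.mem_Icc.1 hI
  exact ⟨h2, (Nat.mul_le_mul_right b (by omega)).trans (Nat.div_mul_le_self n b)⟩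

lemma two_mul_le_of_mem_innerIndices {n b I : ℕ} (hI : I ∈ innerIndices n b) : 2 * b ≤ n :=
  have ⟨_, hIn⟩ := add_three_mul_le_of_mem_innerIndices hI
  (Nat.mul_le_mul_right b (by omega)).trans hIn

lemma le_card_coveringStarts {n b I r : ℕ} (hI : I ∈ innerIndices n b) (h : Meets b I r b) :
    b ≤ (coveringStarts n b r).card := by
  obtain ⟨hI2, hIn⟩ := add_three_mul_le_of_mem_innerIndices hI
  have hbr : b ≤ r := by
    have := (Nat.mul_le_mul_right b hI2).trans_lt h.2
    omega
  have hrn : r + 2 * b ≤ n := by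
    have := h.1
    linarith
  calc b = (Finset.Ioc (r - b) r).card := by rw [Nat.card_Ioc, Nat.sub_sub_self hbr]
    _ ≤ (coveringStarts n b r).card := Finset.card_le_card fun s hs => by
        rw [Finset.mem_Ioc] at hs
        exact mem_coveringStarts.2 (by omega)

/- Double counting: every first occurrence of side `b` is contained in many windows of side `2 * b`,
all of them first occurrences again, and a window of side `2 * b` meets at most nine blocks. -/
lemma card_mul_le_card_firstOccs_mul (M : Matrix (Fin n) (Fin n) S) {b m : ℕ}
    {P : Finset (ℕ × ℕ)} (hP : ∀ p ∈ P, IsMarked M b p)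
    (hm : ∀ p ∈ P, ∀ r c, r + b ≤ n → c + b ≤ n → Meets b p.1 r b → Meets b p.2 c b →
      m ≤ (coveringStarts n b r).card * (coveringStarts n b c).card) :
    P.card * m ≤ (firstOccs M (2 * b)).card * 9 := by
  classical
  refine Finset.card_mul_le_card_mul
    (fun p q : ℕ × ℕ => Meets b p.1 q.1 (2 * b) ∧ Meets b p.2 q.2 (2 * b)) ?_ ?_
  · intro p hp
    obtain ⟨r, c, hocc, hr, hc⟩ := hP p hp
    obtain ⟨hrn, hcn, _⟩ := id hocc
    refine (hm p hp r c hrn hcn hr hc).trans ?_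
    rw [← Finset.card_product]
    refine Finset.card_le_card fun q hq => ?_
    obtain ⟨hq₁, hq₂⟩ := Finset.mem_product.1 hq
    rw [mem_coveringStarts] at hq₁ hq₂
    exact (Finset.mem_bipartiteAbove _).2
      ⟨mem_firstOccs.2 (hocc.enlarge (by omega) (by omega) (by omega) (by omega) (by omega)
        (by omega)), Meets.mono hr hq₁.1 (by omega), Meets.mono hc hq₂.1 (by omega)⟩
  · intro q _
    refine (Finset.card_le_card (t := Finset.Icc (q.1 / b) (q.1 / b + 2) ×ˢ
      Finset.Icc (q.2 / b) (q.2 / b + 2)) fun p hp => ?_).trans_eq ?_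
    · obtain ⟨_, h₁, h₂⟩ := (Finset.mem_bipartiteBelow _).1 hp
      exact Finset.mem_product.2 ⟨h₁.mem_Icc, h₂.mem_Icc⟩
    · simp [Nat.add_assoc]

lemma card_marked_inner_le (M : Matrix (Fin n) (Fin n) S) {b : ℕ} (hb : 1 ≤ b)
    {P : Finset (ℕ × ℕ)} (hP : ∀ p ∈ P, IsMarked M b p)
    (hI : P ⊆ innerIndices n b ×ˢ innerIndices n b) : (P.card : ℝ) ≤ 36 * delta2D M := by
  have hcount : P.card * b ^ 2 ≤ (firstOccs M (2 * b)).card * 9 :=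
    card_mul_le_card_firstOccs_mul M hP fun p hp r c _ _ hr hc => by
      obtain ⟨h₁, h₂⟩ := Finset.mem_product.1 (hI hp)
      rw [sq]
      exact Nat.mul_le_mul (le_card_coveringStarts h₁ hr) (le_card_coveringStarts h₂ hc)
  have hcount' : (P.card : ℝ) * (b : ℝ) ^ 2 ≤ (firstOccs M (2 * b)).card * 9 := by
    exact_mod_cast hcount
  refine le_of_mul_le_mul_right ?_ (by positivity : (0 : ℝ) < (b : ℝ) ^ 2)
  linarith [card_firstOccs_two_mul_le M hb]

/- The number of these blocks is at most `36 * δ * b`, by double counting, and at most `10 * n / b`,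
because they lie along the border. The bound is the geometric mean of the two. -/
lemma card_marked_edge_le (M : Matrix (Fin n) (Fin n) S) {b : ℕ} (hb : 1 ≤ b)
    {P : Finset (ℕ × ℕ)} (hP : ∀ p ∈ P, IsMarked M b p)
    (hI : P ⊆ innerIndices n b ×ˢ outerIndices n b ∪ outerIndices n b ×ˢ innerIndices n b) :
    (P.card : ℝ) ≤ 19 * Real.sqrt (n * delta2D M) := by
  have hcount : P.card * b ≤ (firstOccs M (2 * b)).card * 9 :=
    card_mul_le_card_firstOccs_mul M hP fun p hp r c hrn hcn hr hc => by
      rcases Finset.mem_union.1 (hI hp) with h | h <;> obtain ⟨h₁, h₂⟩ := Finset.mem_product.1 h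
      · exact (le_card_coveringStarts h₁ hr).trans (Nat.le_mul_of_pos_right _
          (coveringStarts_nonempty hcn (two_mul_le_of_mem_innerIndices h₁)).card_pos)
      · exact (le_card_coveringStarts h₂ hc).trans (Nat.le_mul_of_pos_left _
          (coveringStarts_nonempty hrn (two_mul_le_of_mem_innerIndices h₂)).card_pos)
  have hborder : P.card * b ≤ 10 * n :=
    calc P.card * b
        ≤ ((innerIndices n b).card * (outerIndices n b).card +
            (outerIndices n b).card * (innerIndices n b).card) * b := by
          rw [← Finset.card_product, ← Finset.card_product]
          exact Nat.mul_le_mul_right b ((Finset.card_le_card hI).trans (Finset.card_union_le _ _))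
      _ ≤ (n / b * 5 + 5 * (n / b)) * b := by
          gcongr
          exacts [card_innerIndices_le n b, card_outerIndices_le n b, card_outerIndices_le n b,
            card_innerIndices_le n b]
      _ = 10 * (n / b * b) := by ring
      _ ≤ 10 * n := Nat.mul_le_mul_left 10 (Nat.div_mul_le_self n b)
  have hb0 : (0 : ℝ) < b := by exact_mod_cast hb
  have hcount' : (P.card : ℝ) ≤ 36 * delta2D M * b := by
    have : (P.card : ℝ) * b ≤ (firstOccs M (2 * b)).card * 9 := by exact_mod_cast hcount
    refine le_of_mul_le_mul_right ?_ hb0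
    linarith [card_firstOccs_two_mul_le M hb]
  have hborder' : (P.card : ℝ) * b ≤ 10 * n := by exact_mod_cast hborder
  have hsq : ((P.card : ℝ) / 19) ^ 2 ≤ n * delta2D M := by
    have hmul := mul_le_mul hcount' hborder' (by positivity) ((Nat.cast_nonneg _).trans hcount')
    have : (P.card : ℝ) ^ 2 ≤ 360 * (n * delta2D M) :=
      le_of_mul_le_mul_right (by linarith) hb0
    linarith [sq_nonneg (P.card : ℝ)]
  linarith [Real.le_sqrt_of_sq_le hsq]

lemma blocks_subset_inner_union_outer (n : ℕ) {b : ℕ} (hb : 1 ≤ b) :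
    blocks n b ⊆
      (innerIndices n b ∪ outerIndices n b) ×ˢ (innerIndices n b ∪ outerIndices n b) := by
  have hindex : ∀ I, I * b < n → I ∈ innerIndices n b ∪ outerIndices n b := fun I hI => by
    rw [outerIndices, Finset.union_sdiff_self_eq_union]
    exact Finset.mem_union_right _
      (Finset.mem_range_succ_iff.2 ((Nat.le_div_iff_mul_le hb).2 hI.le))
  intro p hp
  obtain ⟨h₁, h₂⟩ := (Finset.mem_filter.1 hp).2
  exact Finset.mem_product.2 ⟨hindex _ h₁, hindex _ h₂⟩

open Classical in
/-- The marked blocks of side `b`. -/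
noncomputable def markedBlocks (M : Matrix (Fin n) (Fin n) S) (b : ℕ) : Finset (ℕ × ℕ) :=
  (blocks n b).filter (IsMarked M b)

theorem card_markedBlocks_le (M : Matrix (Fin n) (Fin n) S) (hn : 1 ≤ n) {b : ℕ} (hb : 1 ≤ b) :
    ((markedBlocks M b).card : ℝ) ≤ 61 * (delta2D M + Real.sqrt (n * delta2D M)) := by
  classical
  set inner := innerIndices n b
  set outer := outerIndices n b
  have hmarked : ∀ Q, ∀ p ∈ markedBlocks M b ∩ Q, IsMarked M b p := fun Q p hp =>
    (Finset.mem_filter.1 (Finset.mem_inter.1 hp).1).2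
  have hinner := card_marked_inner_le M hb (hmarked (inner ×ˢ inner)) Finset.inter_subset_right
  have hedge := card_marked_edge_le M hb (hmarked (inner ×ˢ outer ∪ outer ×ˢ inner))
    Finset.inter_subset_right
  have hcorner : ((outer ×ˢ outer).card : ℝ) ≤ 25 := by
    rw [Finset.card_product]
    exact_mod_cast Nat.mul_le_mul (card_outerIndices_le n b) (card_outerIndices_le n b)
  have hcover : markedBlocks M b ⊆ markedBlocks M b ∩ (inner ×ˢ inner) ∪
      (markedBlocks M b ∩ (inner ×ˢ outer ∪ outer ×ˢ inner) ∪ outer ×ˢ outer) := fun p hp => by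
    have := blocks_subset_inner_union_outer n hb (Finset.filter_subset _ _ hp)
    simp only [Finset.mem_union, Finset.mem_inter, Finset.mem_product] at this ⊢
    tauto
  have hcard : ((markedBlocks M b).card : ℝ) ≤ (markedBlocks M b ∩ (inner ×ˢ inner)).card +
      ((markedBlocks M b ∩ (inner ×ˢ outer ∪ outer ×ˢ inner)).card + (outer ×ˢ outer).card) := by
    exact_mod_cast (Finset.card_le_card hcover).trans ((Finset.card_union_le _ _).trans
      (Nat.add_le_add_left (Finset.card_union_le _ _) _))
  linarith [one_le_delta2D M hn, Real.sqrt_nonneg (n * delta2D M)]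

end MarkedBlocks

section Nodes

lemma one_le_div_sqrt_delta2D (M : Matrix (Fin n) (Fin n) S) (hn : 1 ≤ n) :
    1 ≤ (n : ℝ) / Real.sqrt (delta2D M) := by
  rw [one_le_div (Real.sqrt_pos.2 (zero_lt_one.trans_le (one_le_delta2D M hn)))]
  exact Real.sqrt_le_iff.2 ⟨Nat.cast_nonneg n, delta2D_le_sq M⟩

lemma pow_topExp_le (M : Matrix (Fin n) (Fin n) S) (hn : 1 ≤ n) (k : ℕ) :
    (k : ℝ) ^ topExp M k ≤ (n : ℝ) / Real.sqrt (delta2D M) := by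
  have hone := one_le_div_sqrt_delta2D M hn
  refine le_trans ?_ (Nat.floor_le (zero_le_one.trans hone))
  exact_mod_cast Nat.pow_log_le_self k (Nat.floor_pos.2 hone).ne'

lemma lt_pow_topExp_succ (M : Matrix (Fin n) (Fin n) S) {k : ℕ} (hk : 2 ≤ k) :
    (n : ℝ) / Real.sqrt (delta2D M) < (k : ℝ) ^ (topExp M k + 1) := by
  exact_mod_cast Nat.lt_of_floor_lt (Nat.lt_pow_succ_log_self hk _)

lemma topExp_le (M : Matrix (Fin n) (Fin n) S) (hn : 1 ≤ n) {k : ℕ} (hk : 2 ≤ k) :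
    (topExp M k : ℝ) ≤ 2 * Real.log (n / Real.sqrt (delta2D M)) := by
  have hpow : (2 : ℝ) ^ topExp M k ≤ n / Real.sqrt (delta2D M) :=
    (pow_le_pow_left₀ zero_le_two (by exact_mod_cast hk) _).trans (pow_topExp_le M hn k)
  have hlog := Real.log_le_log (by positivity) hpow
  rw [Real.log_pow] at hlog
  nlinarith [Real.log_two_gt_d9, (Nat.cast_nonneg _ : (0 : ℝ) ≤ topExp M k)]

lemma card_blocks_le {b : ℕ} {x : ℝ} (hx : 0 ≤ x) (h : (n : ℝ) ≤ x * b) :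
    ((blocks n b).card : ℝ) ≤ (x + 1) ^ 2 := by
  have hindex : ∀ I : ℕ, I * b < n → I ∈ Finset.range ⌈x⌉₊ := fun I hI => by
    have hI' : (I : ℝ) * b < n := by exact_mod_cast hI
    exact Finset.mem_range.2
      (Nat.lt_ceil.2 (lt_of_mul_lt_mul_right (hI'.trans_le h) (Nat.cast_nonneg b)))
  have hcard : (blocks n b).card ≤ ⌈x⌉₊ ^ 2 := by
    refine (Finset.card_le_card (t := Finset.range ⌈x⌉₊ ×ˢ Finset.range ⌈x⌉₊) fun p hp => ?_).trans
      (by simp [sq])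
    obtain ⟨h₁, h₂⟩ := (Finset.mem_filter.1 hp).2
    exact Finset.mem_product.2 ⟨hindex _ h₁, hindex _ h₂⟩
  calc ((blocks n b).card : ℝ) ≤ (⌈x⌉₊ : ℝ) ^ 2 := by exact_mod_cast hcard
    _ ≤ (x + 1) ^ 2 := pow_le_pow_left₀ (Nat.cast_nonneg _) (Nat.ceil_lt_add_one hx).le 2

lemma card_nodes_zero_le (M : Matrix (Fin n) (Fin n) S) (hn : 1 ≤ n) {k : ℕ} (hk : 2 ≤ k) :
    ((nodes M k 0).card : ℝ) ≤ ((k : ℝ) + 1) ^ 2 * delta2D M := by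
  have hδ := one_le_delta2D M hn
  set s := Real.sqrt (delta2D M) with hs
  have hs1 : 1 ≤ s := Real.one_le_sqrt.2 hδ
  have hside : (n : ℝ) ≤ k * s * (k ^ topExp M k : ℕ) := by
    have := (div_lt_iff₀ (zero_lt_one.trans_le hs1)).1 (lt_pow_topExp_succ M hk)
    rw [pow_succ] at this
    push_cast
    linarith
  calc ((nodes M k 0).card : ℝ) ≤ (k * s + 1) ^ 2 := card_blocks_le (by positivity) hside
    _ ≤ (k * s + s) ^ 2 := by gcongr
    _ = (k + 1) ^ 2 * s ^ 2 := by ring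
    _ = (k + 1) ^ 2 * delta2D M := by rw [hs, Real.sq_sqrt (zero_le_one.trans hδ)]

lemma card_le_sq_mul_card_of_div_mem {k : ℕ} (hk : 1 ≤ k) {P Q : Finset (ℕ × ℕ)}
    (h : ∀ p ∈ P, (p.1 / k, p.2 / k) ∈ Q) : P.card ≤ k ^ 2 * Q.card := by
  refine Finset.card_le_mul_card_image_of_maps_to (f := fun p : ℕ × ℕ => (p.1 / k, p.2 / k)) h _
    fun q _ => ?_
  have hindex : ∀ i : ℕ, i ∈ Finset.Ico (i / k * k) (i / k * k + k) := fun i =>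
    Finset.mem_Ico.2 ⟨Nat.div_mul_le_self i k, Nat.lt_div_mul_add hk⟩
  refine (Finset.card_le_card (t := Finset.Ico (q.1 * k) (q.1 * k + k) ×ˢ
    Finset.Ico (q.2 * k) (q.2 * k + k)) fun p hp => ?_).trans_eq (by simp [sq])
  obtain rfl := (Finset.mem_filter.1 hp).2
  exact Finset.mem_product.2 ⟨hindex p.1, hindex p.2⟩

lemma nodes_subset_blocks (M : Matrix (Fin n) (Fin n) S) (k l : ℕ) :
    nodes M k l ⊆ blocks n (k ^ (topExp M k - l)) := by
  cases l with
  | zero => exact subset_rfl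
  | succ l =>
    classical
    exact Finset.filter_subset _ _

lemma card_nodes_succ_le (M : Matrix (Fin n) (Fin n) S) {k : ℕ} (hk : 1 ≤ k) (l : ℕ) :
    (nodes M k (l + 1)).card ≤ k ^ 2 * (markedBlocks M (k ^ (topExp M k - l))).card := by
  classical
  refine card_le_sq_mul_card_of_div_mem hk fun p hp => ?_
  obtain ⟨hparent, hmarked⟩ := (Finset.mem_filter.1 hp).2
  exact Finset.mem_filter.2 ⟨nodes_subset_blocks M k l hparent, hmarked⟩

lemma card_nodes_le (M : Matrix (Fin n) (Fin n) S) (hn : 1 ≤ n) {k : ℕ} (hk : 2 ≤ k) (l : ℕ) :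
    ((nodes M k l).card : ℝ) ≤
      61 * ((k : ℝ) + 1) ^ 2 * (delta2D M + Real.sqrt (n * delta2D M)) := by
  have hδ := one_le_delta2D M hn
  have hs := Real.sqrt_nonneg (n * delta2D M)
  cases l with
  | zero =>
    calc ((nodes M k 0).card : ℝ) ≤ ((k : ℝ) + 1) ^ 2 * delta2D M := card_nodes_zero_le M hn hk
      _ ≤ ((k : ℝ) + 1) ^ 2 * (61 * (delta2D M + Real.sqrt (n * delta2D M))) := by
        gcongr
        linarith
      _ = _ := by ring
  | succ l =>
    calc ((nodes M k (l + 1)).card : ℝ)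
        ≤ (k : ℝ) ^ 2 * (markedBlocks M (k ^ (topExp M k - l))).card := by
          exact_mod_cast card_nodes_succ_le M (by omega) l
      _ ≤ ((k : ℝ) + 1) ^ 2 * (61 * (delta2D M + Real.sqrt (n * delta2D M))) := by
        gcongr
        · linarith
        · exact card_markedBlocks_le M hn (Nat.one_le_pow _ _ (by omega))
      _ = _ := by ring

end Nodes

section Space

lemma alphabetSize_le_sq (M : Matrix (Fin n) (Fin n) S) : alphabetSize M ≤ n ^ 2 := by
  rw [alphabetSize, ← Nat.card_coe_set_eq]
  exact (Finite.card_range_le _).trans_eq (by simp [sq])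

lemma clog_alphabetSize_le (M : Matrix (Fin n) (Fin n) S) {w : ℕ} (hw : Nat.size n ≤ w) :
    Nat.clog 2 (alphabetSize M) ≤ 2 * w := by
  refine Nat.clog_le_of_le_pow ((alphabetSize_le_sq M).trans ?_)
  rw [mul_comm, pow_mul]
  exact Nat.pow_le_pow_left (Nat.size_le.1 hw).le 2

lemma explicitWords_bottomExp_le (M : Matrix (Fin n) (Fin n) S) {w : ℕ} (hw : Nat.size n ≤ w)
    (k : ℕ) : explicitWords M w (k ^ bottomExp M k w) ≤ pointerLeafWords := by
  rcases w.eq_zero_or_pos with rfl | hw0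
  · simp [explicitWords]
  · have hcell : (k ^ 0) ^ 2 * Nat.clog 2 (alphabetSize M) ≤ pointerLeafWords * w := by
      rw [pow_zero, one_pow, one_mul, pointerLeafWords]
      linarith [clog_alphabetSize_le M hw]
    rw [explicitWords, ceilDiv_le_iff_le_mul hw0, mul_comm w]
    exact Nat.findGreatest_spec (P := fun e =>
      (k ^ e) ^ 2 * Nat.clog 2 (alphabetSize M) ≤ pointerLeafWords * w) (Nat.zero_le _) hcell

lemma nodeWords_le (M : Matrix (Fin n) (Fin n) S) {w : ℕ} (hw : Nat.size n ≤ w) (k l : ℕ)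
    (p : ℕ × ℕ) : nodeWords M k w l p ≤ 11 + 2 * k ^ 2 := by
  have hexplicit := explicitWords_bottomExp_le M hw k
  rw [pointerLeafWords] at hexplicit
  rw [nodeWords, pointerLeafWords]
  split_ifs <;> omega

lemma spaceWords_le_of_card_nodes_le (M : Matrix (Fin n) (Fin n) S) {k w : ℕ}
    (hw : Nat.size n ≤ w) {A : ℝ} (hA : ∀ l, ((nodes M k l).card : ℝ) ≤ A) :
    (spaceWords M k w : ℝ) ≤ 2 * A + (topExp M k + 1) * (A * (11 + 2 * (k : ℝ) ^ 2)) := by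
  have hlevel : ∀ l, (∑ p ∈ nodes M k l, (nodeWords M k w l p : ℝ)) ≤
      A * (11 + 2 * (k : ℝ) ^ 2) := fun l =>
    calc (∑ p ∈ nodes M k l, (nodeWords M k w l p : ℝ))
        ≤ ∑ _p ∈ nodes M k l, (11 + 2 * (k : ℝ) ^ 2) :=
          Finset.sum_le_sum fun p _ => by exact_mod_cast nodeWords_le M hw k l p
      _ = (nodes M k l).card * (11 + 2 * (k : ℝ) ^ 2) := by rw [Finset.sum_const, nsmul_eq_mul]
      _ ≤ A * (11 + 2 * (k : ℝ) ^ 2) := by gcongr; exact hA l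
  have hA0 : 0 ≤ A := (Nat.cast_nonneg _).trans (hA 0)
  rw [spaceWords]
  push_cast
  gcongr
  · exact hA 0
  calc (∑ l ∈ Finset.range (lastLevel M k w + 1), ∑ p ∈ nodes M k l, (nodeWords M k w l p : ℝ))
      ≤ ∑ _l ∈ Finset.range (lastLevel M k w + 1), A * (11 + 2 * (k : ℝ) ^ 2) :=
        Finset.sum_le_sum fun l _ => hlevel l
    _ = (lastLevel M k w + 1 : ℕ) * (A * (11 + 2 * (k : ℝ) ^ 2)) := by
        rw [Finset.sum_const, nsmul_eq_mul, Finset.card_range]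
    _ ≤ (topExp M k + 1) * (A * (11 + 2 * (k : ℝ) ^ 2)) := by
        gcongr
        exact_mod_cast Nat.succ_le_succ (Nat.sub_le _ _)

/-- The constant of the space bounds, for the arity parameter `k`: every level has at most
`61 * (k + 1) ^ 2 * (δ + √(n * δ))` nodes of at most `11 + 2 * k ^ 2` words each, there are at most
`2 * (1 + log (n / √δ))` levels, and the root needs two more words for each node of level `0`. -/
def spaceConstant (k : ℕ) : ℝ := 61 * ((k : ℝ) + 1) ^ 2 * (24 + 4 * (k : ℝ) ^ 2)

lemma spaceConstant_pos (k : ℕ) : 0 < spaceConstant k := by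
  unfold spaceConstant
  positivity

theorem spaceWords_le (M : Matrix (Fin n) (Fin n) S) (hn : 1 ≤ n) {k : ℕ} (hk : 2 ≤ k) {w : ℕ}
    (hw : Nat.size n ≤ w) :
    (spaceWords M k w : ℝ) ≤ spaceConstant k * ((delta2D M + Real.sqrt (n * delta2D M)) *
      (1 + Real.log (n / Real.sqrt (delta2D M)))) := by
  set x := Real.log (n / Real.sqrt (delta2D M))
  set A := 61 * ((k : ℝ) + 1) ^ 2 * (delta2D M + Real.sqrt (n * delta2D M)) with hA
  have hA0 : 0 ≤ A := (Nat.cast_nonneg _).trans (card_nodes_le M hn hk 0)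
  have hx0 : 0 ≤ x := Real.log_nonneg (one_le_div_sqrt_delta2D M hn)
  have hlevels : (topExp M k : ℝ) + 1 ≤ 2 * (1 + x) := by linarith [topExp_le M hn hk]
  calc (spaceWords M k w : ℝ) ≤ 2 * A + (topExp M k + 1) * (A * (11 + 2 * (k : ℝ) ^ 2)) :=
        spaceWords_le_of_card_nodes_le M hw (card_nodes_le M hn hk)
    _ ≤ 2 * (A * (1 + x)) + 2 * (1 + x) * (A * (11 + 2 * (k : ℝ) ^ 2)) := by
        gcongr
        exact le_mul_of_one_le_right hA0 (by linarith)
    _ = _ := by rw [spaceConstant, hA]; ring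

lemma one_add_log_div_sqrt_delta2D_le (M : Matrix (Fin n) (Fin n) S) (hn : 2 ≤ n) :
    1 + Real.log (n / Real.sqrt (delta2D M)) ≤ 3 * Real.log n := by
  have hquot := one_le_div_sqrt_delta2D M (one_le_two.trans hn)
  have hle : Real.log (n / Real.sqrt (delta2D M)) ≤ Real.log n :=
    Real.log_le_log (zero_lt_one.trans_le hquot) (div_le_self (Nat.cast_nonneg n)
      (Real.one_le_sqrt.2 (one_le_delta2D M (one_le_two.trans hn))))
  have htwo : Real.log 2 ≤ Real.log n := Real.log_le_log (by norm_num) (by exact_mod_cast hn)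
  linarith [Real.log_two_gt_d9]

lemma mul_log_le_log_div_of_le_rpow {x y ε : ℝ} (hx : 0 < x) (hy : 0 < y) (h : y ≤ x ^ (1 - ε)) :
    ε * Real.log x ≤ Real.log (x / y) := by
  have hlog := Real.log_le_log hy h
  rw [Real.log_rpow hx] at hlog
  rw [Real.log_div hx.ne' hy.ne']
  linarith

theorem spaceWords_le_of_delta2D_le_rpow (M : Matrix (Fin n) (Fin n) S) (hn : 2 ≤ n) {k : ℕ}
    (hk : 2 ≤ k) {w : ℕ} (hw : Nat.size n ≤ w) {ε : ℝ} (hε : 0 < ε)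
    (hδ : delta2D M ≤ (n : ℝ) ^ (1 - ε)) :
    (spaceWords M k w : ℝ) ≤ spaceConstant k * (3 / ε) *
      ((delta2D M + Real.sqrt (n * delta2D M)) * Real.log (n / delta2D M)) := by
  have hδ0 : 0 < delta2D M := zero_lt_one.trans_le (one_le_delta2D M (one_le_two.trans hn))
  have hlog : 1 + Real.log (n / Real.sqrt (delta2D M)) ≤ 3 / ε * Real.log (n / delta2D M) :=
    calc 1 + Real.log (n / Real.sqrt (delta2D M)) ≤ 3 * Real.log n :=
          one_add_log_div_sqrt_delta2D_le M hn
      _ = 3 / ε * (ε * Real.log n) := by field_simp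
      _ ≤ 3 / ε * Real.log (n / delta2D M) := by
          gcongr
          exact mul_log_le_log_div_of_le_rpow (by positivity) hδ0 hδ
  have hK := spaceConstant_pos k
  calc (spaceWords M k w : ℝ) ≤ spaceConstant k * ((delta2D M + Real.sqrt (n * delta2D M)) *
        (1 + Real.log (n / Real.sqrt (delta2D M)))) :=
        spaceWords_le M (one_le_two.trans hn) hk hw
    _ ≤ spaceConstant k * ((delta2D M + Real.sqrt (n * delta2D M)) *
        (3 / ε * Real.log (n / delta2D M))) := by gcongr
    _ = _ := by ring

lemma IsWordSize.exists_le_log {w : ℕ → ℕ} (hw : IsWordSize w) :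
    ∃ C : ℝ, 0 < C ∧ ∀ n : ℕ, 2 ≤ n → (w n : ℝ) ≤ C * Real.log n := by
  obtain ⟨C, hC, hbound⟩ := bound_of_isBigO_nat_atTop hw.2.1
  refine ⟨C, hC, fun n hn => ?_⟩
  have hlog : 0 < Real.log n := Real.log_pos (by exact_mod_cast hn)
  simpa only [Real.norm_of_nonneg (Nat.cast_nonneg _), Real.norm_of_nonneg hlog.le] using
    hbound hlog.ne'

lemma delta2D_add_sqrt_le (M : Matrix (Fin n) (Fin n) S) (hn : 1 ≤ n) {D : ℝ}
    (hD : delta2D M ≤ D) : delta2D M + Real.sqrt (n * delta2D M) ≤ 2 * D * Real.sqrt n := by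
  have hδ := one_le_delta2D M hn
  have hD0 : 0 ≤ D := zero_le_one.trans (hδ.trans hD)
  have hsqrt : 1 ≤ Real.sqrt n := Real.one_le_sqrt.2 (by exact_mod_cast hn)
  calc delta2D M + Real.sqrt (n * delta2D M)
      = delta2D M * 1 + Real.sqrt (delta2D M) * Real.sqrt n := by
        rw [Real.sqrt_mul (Nat.cast_nonneg n), mul_one, mul_comm (Real.sqrt n)]
    _ ≤ D * Real.sqrt n + D * Real.sqrt n := by
        gcongr
        exact (Real.sqrt_le_self_iff.2 (Or.inr hδ)).trans hD
    _ = 2 * D * Real.sqrt n := by ring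

theorem IsWordSize.exists_spaceWords_mul_le {w : ℕ → ℕ} (hw : IsWordSize w) {k : ℕ} (hk : 2 ≤ k)
    {D : ℝ} (hD : 0 < D) :
    ∃ C : ℝ, 0 < C ∧ ∀ (S : Type u) (n : ℕ) (M : Matrix (Fin n) (Fin n) S), 2 ≤ n →
      delta2D M ≤ D →
        ((spaceWords M k (w n) * w n : ℕ) : ℝ) ≤ C * (Real.sqrt n * Real.log n ^ 2) := by
  obtain ⟨C, hC, hlog⟩ := hw.exists_le_log
  have hK := spaceConstant_pos k
  refine ⟨6 * spaceConstant k * D * C, by positivity, fun S n M hn hδ => ?_⟩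
  have hn1 : 1 ≤ n := one_le_two.trans hn
  have : 0 ≤ Real.log n := Real.log_natCast_nonneg n
  have := Real.log_nonneg (one_le_div_sqrt_delta2D M hn1)
  have hspace : (spaceWords M k (w n) : ℝ) ≤
      spaceConstant k * (2 * D * Real.sqrt n * (3 * Real.log n)) :=
    (spaceWords_le M hn1 hk (hw.1 n)).trans (by
      gcongr
      exacts [delta2D_add_sqrt_le M hn1 hδ, one_add_log_div_sqrt_delta2D_le M hn])
  rw [Nat.cast_mul]
  calc (spaceWords M k (w n) : ℝ) * w n
      ≤ spaceConstant k * (2 * D * Real.sqrt n * (3 * Real.log n)) * (C * Real.log n) :=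
        mul_le_mul hspace (hlog n hn) (Nat.cast_nonneg _) (by positivity)
    _ = _ := by ring

end Space

section SparseMatrices

open Classical in
/-- The `n × n` matrix that is `1` in the columns of `A` of the first row and `0` elsewhere. -/
noncomputable def topRowIndicator (n : ℕ) (A : Set ℕ) : Matrix (Fin n) (Fin n) (Fin 3) :=
  fun i j => if (i : ℕ) = 0 ∧ (j : ℕ) ∈ A then 1 else 0

lemma topRowIndicator_inj {A B : Set ℕ} :
    topRowIndicator n A = topRowIndicator n B ↔ ∀ j < n, j ∈ A ↔ j ∈ B := by
  classical
  refine ⟨fun h j hj => ?_, fun h => ?_⟩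
  · have hentry := congr_fun₂ h ⟨0, by omega⟩ ⟨j, hj⟩
    by_cases hA : j ∈ A <;> by_cases hB : j ∈ B <;> simp_all [topRowIndicator]
  · exact Matrix.ext fun i j => if_congr (and_congr_right fun _ => h j j.isLt) rfl rfl

lemma window_topRowIndicator (A : Set ℕ) {b r c : ℕ} (hr : r + b ≤ n) (hc : c + b ≤ n) :
    window (topRowIndicator n A) b r c hr hc = topRowIndicator b {j | r = 0 ∧ c + j ∈ A} := by
  refine Matrix.ext fun i j => ?_
  have hiff : (r + i = 0 ∧ c + j ∈ A) ↔ ((i : ℕ) = 0 ∧ r = 0 ∧ c + j ∈ A) := by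
    rw [Nat.add_eq_zero_iff, and_assoc, and_left_comm]
  simp only [window, topRowIndicator, Matrix.submatrix_apply, Set.mem_ofPred_eq]
  congr 1
  exact propext hiff

/- Apart from the zero matrix, only the windows in the first row matter. -/
lemma distinctCount_topRowIndicator_le_succ {A : Set ℕ} {b m : ℕ} (g : ℕ → Set ℕ)
    (h : ∀ c, c + b ≤ n → topRowIndicator b {j | c + j ∈ A} = topRowIndicator b ∅ ∨
      ∃ i < m, topRowIndicator b (g i) = topRowIndicator b {j | c + j ∈ A}) :
    distinctCount (topRowIndicator n A) b ≤ m + 1 := by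
  set G := (fun i => topRowIndicator b (g i)) '' Set.Iio m
  have hG : G.Finite := (Set.finite_Iio m).image _
  have hsub : windowSet (topRowIndicator n A) b ⊆ insert (topRowIndicator b ∅) G := by
    rintro _ ⟨r, c, hr, hc, rfl⟩
    rw [window_topRowIndicator]
    rcases eq_or_ne r 0 with rfl | hr0
    · exact (h c hc).imp (by simp only [true_and, imp_self]) (by simp [G])
    · exact Or.inl (topRowIndicator_inj.2 fun j _ => iff_of_false (fun hj => hr0 hj.1) id)
  calc (windowSet (topRowIndicator n A) b).ncard
      ≤ (insert (topRowIndicator b ∅) G).ncard := Set.ncard_le_ncard hsub (hG.insert _)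
    _ ≤ G.ncard + 1 := Set.ncard_insert_le _ _
    _ ≤ m + 1 := by
        simpa using Set.ncard_image_le (f := fun i => topRowIndicator b (g i)) (Set.finite_Iio m)

lemma distinctCount_topRowIndicator_le (A : Set ℕ) (b : ℕ) :
    distinctCount (topRowIndicator n A) b ≤ n + 1 - b + 1 :=
  distinctCount_topRowIndicator_le_succ (fun c => {j | c + j ∈ A}) fun c _ =>
    Or.inr ⟨c, by omega, rfl⟩

/-- Any two elements of `A` are equal or differ by at least `q`. -/
def HasGaps (q : ℕ) (A : Set ℕ) : Prop := ∀ x ∈ A, ∀ y ∈ A, x < y → x + q ≤ y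

lemma HasGaps.distinctCount_topRowIndicator_le {q : ℕ} {A : Set ℕ} (hA : HasGaps q A) {b : ℕ}
    (hb : b ≤ q) : distinctCount (topRowIndicator n A) b ≤ b + 1 := by
  refine distinctCount_topRowIndicator_le_succ (fun i => {i}) fun c _ => ?_
  by_cases h : ∃ i < b, c + i ∈ A
  · obtain ⟨i, hi, hiA⟩ := h
    refine Or.inr ⟨i, hi, topRowIndicator_inj.2 fun j hj => ⟨?_, fun hjA => ?_⟩⟩
    · rintro rfl
      exact hiA
    · have hij := hA _ hiA _ hjA
      have hji := hA _ hjA _ hiA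
      rw [Set.mem_singleton_iff]
      omega
  · exact Or.inl (topRowIndicator_inj.2 fun j hj => iff_of_false (fun hjA => h ⟨j, hj, hjA⟩) id)

/-- The `n × n` matrices whose only nonzero entries are ones in the first row, at pairwise distances
of at least `⌊√n⌋`. They have bounded `δ_2D`, but there are `2 ^ Ω(√n * log n)` of them. -/
def sparseRowMatrices (n : ℕ) : Set (Matrix (Fin n) (Fin n) (Fin 3)) :=
  topRowIndicator n '' {A | HasGaps (Nat.sqrt n) A}

lemma delta2D_le_two_of_mem_sparseRowMatrices {M : Matrix (Fin n) (Fin n) (Fin 3)}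
    (hM : M ∈ sparseRowMatrices n) : delta2D M ≤ 2 := by
  obtain ⟨A, hA, rfl⟩ := hM
  refine delta2D_le _ zero_le_two fun b hb _ => ?_
  suffices distinctCount (topRowIndicator n A) b ≤ 2 * b ^ 2 by exact_mod_cast this
  rcases le_or_gt b (Nat.sqrt n) with hshort | hlong
  · calc distinctCount (topRowIndicator n A) b ≤ b + 1 :=
          HasGaps.distinctCount_topRowIndicator_le hA hshort
      _ ≤ 2 * b ^ 2 := by nlinarith
  · calc distinctCount (topRowIndicator n A) b ≤ n + 1 - b + 1 :=
          distinctCount_topRowIndicator_le A b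
      _ ≤ 2 * b ^ 2 := by
          have := Nat.sqrt_lt'.1 hlong
          omega

/-- The set with one element, chosen by `f`, in the first half of each of the slots
`[2 * s * t, 2 * s * (t + 1))`, `t < T`. -/
def slotSet {s T : ℕ} (f : Fin T → Fin (s + 1)) : Set ℕ := Set.range fun t => 2 * s * t + f t

lemma slot_add_le {s T : ℕ} (f g : Fin T → Fin (s + 1)) {t t' : Fin T} (h : t < t') :
    2 * s * t + f t + s ≤ 2 * s * t' + g t' := by
  have hf := (f t).is_le
  have hslot := Nat.mul_le_mul_left (2 * s) (Fin.lt_def.1 h)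
  rw [Nat.mul_succ] at hslot
  omega

lemma hasGaps_slotSet {s T : ℕ} (f : Fin T → Fin (s + 1)) : HasGaps s (slotSet f) := by
  rintro _ ⟨t, rfl⟩ _ ⟨t', rfl⟩ hlt
  rcases lt_trichotomy t t' with h | rfl | h
  · exact slot_add_le f f h
  · exact absurd hlt (lt_irrefl _)
  · exact absurd hlt ((Nat.le_add_right _ s).trans (slot_add_le f f h)).not_gt

lemma lt_of_mem_slotSet {s T : ℕ} (hs : 1 ≤ s) {f : Fin T → Fin (s + 1)} {x : ℕ}
    (hx : x ∈ slotSet f) : x < 2 * s * T := by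
  obtain ⟨t, rfl⟩ := hx
  have hf := (f t).is_le
  have hslot := Nat.mul_le_mul_left (2 * s) (Nat.succ_le_of_lt t.isLt)
  rw [Nat.mul_succ] at hslot
  dsimp only
  omega

lemma slotSet_injective {s : ℕ} (hs : 1 ≤ s) (T : ℕ) :
    Function.Injective (slotSet : (Fin T → Fin (s + 1)) → Set ℕ) := by
  refine fun f g h => funext fun t => ?_
  obtain ⟨t', ht'⟩ : 2 * s * t + f t ∈ slotSet g := h ▸ ⟨t, rfl⟩
  dsimp only at ht'
  rcases lt_trichotomy t t' with hlt | rfl | hlt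
  · have := slot_add_le f g hlt
    omega
  · exact Fin.ext (Nat.add_left_cancel ht'.symm)
  · have := slot_add_le g f hlt
    omega

lemma succ_sqrt_pow_le_ncard_sparseRowMatrices (hn : 1 ≤ n) :
    (Nat.sqrt n + 1) ^ (n / (2 * Nat.sqrt n)) ≤ (sparseRowMatrices n).ncard := by
  set s := Nat.sqrt n
  set T := n / (2 * s)
  have hs : 1 ≤ s := Nat.sqrt_pos.2 hn
  have hlt : ∀ (f : Fin T → Fin (s + 1)), ∀ x ∈ slotSet f, x < n := fun f x hx =>
    (lt_of_mem_slotSet hs hx).trans_le (Nat.mul_div_le n (2 * s))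
  have hinj : Function.Injective fun f : Fin T → Fin (s + 1) => topRowIndicator n (slotSet f) := by
    refine fun f g h => slotSet_injective hs T (Set.ext fun x => ?_)
    rw [topRowIndicator_inj] at h
    exact ⟨fun hx => (h x (hlt f x hx)).1 hx, fun hx => (h x (hlt g x hx)).2 hx⟩
  calc (s + 1) ^ T = (Set.range fun f : Fin T → Fin (s + 1) =>
        topRowIndicator n (slotSet f)).ncard := by
        rw [← Set.image_univ, Set.ncard_image_of_injective _ hinj, Set.ncard_univ]
        simp
    _ ≤ (sparseRowMatrices n).ncard := by
        refine Set.ncard_le_ncard ?_ (Set.toFinite _)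
        rintro _ ⟨f, rfl⟩
        exact ⟨slotSet f, hasGaps_slotSet f, rfl⟩

lemma sqrt_mul_log_le_log_ncard_sparseRowMatrices (hn : 2 ≤ n) :
    Real.sqrt n * Real.log n ≤ 8 * Real.log (sparseRowMatrices n).ncard := by
  set s := Nat.sqrt n
  set T := n / (2 * s)
  have hs1 : 1 ≤ s := Nat.sqrt_pos.2 (by omega)
  have hss : s * s ≤ n := Nat.sqrt_le n
  have hT1 : 1 ≤ T := (Nat.one_le_div_iff (by omega)).2 (by nlinarith)
  have hsqrt : Real.sqrt n ≤ 4 * T := by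
    have hnat : n ≤ 4 * T * s := by
      have hlt : n < 2 * s * (T + 1) := Nat.lt_mul_div_succ n (by omega)
      nlinarith
    refine le_of_mul_le_mul_right ?_ (Real.sqrt_pos.2 (by positivity : (0 : ℝ) < n))
    calc Real.sqrt n * Real.sqrt n = n := Real.mul_self_sqrt (Nat.cast_nonneg n)
      _ ≤ 4 * T * s := by exact_mod_cast hnat
      _ ≤ 4 * T * Real.sqrt n := by
          gcongr
          exact Real.nat_sqrt_le_real_sqrt
  have hlog : Real.log n ≤ 2 * Real.log (s + 1) := by
    rw [← Nat.cast_ofNat, ← Real.log_pow]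
    refine Real.log_le_log (by positivity) ?_
    exact_mod_cast (Nat.lt_succ_sqrt' n).le
  have hcard : T * Real.log (s + 1) ≤ Real.log (sparseRowMatrices n).ncard := by
    rw [← Real.log_pow]
    refine Real.log_le_log (by positivity) ?_
    exact_mod_cast succ_sqrt_pow_le_ncard_sparseRowMatrices (one_le_two.trans hn)
  calc Real.sqrt n * Real.log n ≤ (4 * T) * (2 * Real.log (s + 1)) :=
        mul_le_mul hsqrt hlog (Real.log_natCast_nonneg n) (by positivity)
    _ = 8 * (T * Real.log (s + 1)) := by ring
    _ ≤ 8 * Real.log (sparseRowMatrices n).ncard := by gcongr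

end SparseMatrices

section Codes

lemma card_lt_pow_of_length_lt {α : Type*} [Fintype α] (hα : 2 ≤ Fintype.card α) {m : ℕ}
    {s : Finset (List α)} (hs : ∀ l ∈ s, l.length < m) : s.card < Fintype.card α ^ m := by
  classical
  have hsub : s ⊆ (Finset.range m).biUnion fun i =>
      (Finset.univ : Finset (List.Vector α i)).image List.Vector.toList := fun l hl =>
    Finset.mem_biUnion.2 ⟨l.length, Finset.mem_range.2 (hs l hl),
      Finset.mem_image.2 ⟨⟨l, rfl⟩, Finset.mem_univ _, rfl⟩⟩
  calc s.card ≤ ∑ i ∈ Finset.range m,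
        ((Finset.univ : Finset (List.Vector α i)).image List.Vector.toList).card :=
        (Finset.card_le_card hsub).trans Finset.card_biUnion_le
    _ ≤ ∑ i ∈ Finset.range m, Fintype.card α ^ i := Finset.sum_le_sum fun i _ =>
        Finset.card_image_le.trans_eq (card_vector i)
    _ < Fintype.card α ^ m := Nat.geomSum_lt hα fun _ => Finset.mem_range.1

lemma exists_log_ncard_le_length {α β : Type*} [Fintype α] (hα : 2 ≤ Fintype.card α) {F : Set β}
    (hfin : F.Finite) (hF : F.Nonempty) {code : β → List α} (hcode : Set.InjOn code F) :
    ∃ W ∈ F, Real.log F.ncard ≤ 2 * Real.log (Fintype.card α) * (code W).length := by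
  classical
  obtain ⟨W, hW, hmax⟩ := F.exists_max_image (fun W => (code W).length) hfin hF
  refine ⟨W, hW, ?_⟩
  set L := (code W).length
  have hcard : F.ncard < Fintype.card α ^ (L + 1) := by
    rw [← hcode.ncard_image, Set.ncard_eq_toFinset_card _ (hfin.image code)]
    refine card_lt_pow_of_length_lt hα fun l hl => ?_
    obtain ⟨V, hV, rfl⟩ := (Set.Finite.mem_toFinset _).1 hl
    exact Nat.lt_succ_of_le (hmax V hV)
  have : 0 ≤ Real.log (Fintype.card α) := Real.log_natCast_nonneg _
  have hF0 : 0 < F.ncard := (Set.ncard_pos hfin).2 hF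
  rcases L.eq_zero_or_pos with hL | hL
  · have hnil : ∀ V ∈ F, code V = [] := fun V hV =>
      List.length_eq_zero_iff.1 (Nat.le_zero.1 ((hmax V hV).trans_eq hL))
    have hone : F.ncard ≤ 1 := (Set.ncard_le_one hfin).2 fun V hV V' hV' =>
      hcode hV hV' ((hnil V hV).trans (hnil V' hV').symm)
    rw [hL, Nat.cast_zero, mul_zero]
    exact Real.log_nonpos (Nat.cast_nonneg _) (by exact_mod_cast hone)
  · calc Real.log F.ncard ≤ Real.log ((Fintype.card α : ℝ) ^ (L + 1)) :=
          Real.log_le_log (by exact_mod_cast hF0) (by exact_mod_cast hcard.le)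
      _ = (L + 1) * Real.log (Fintype.card α) := by rw [Real.log_pow, Nat.cast_succ]
      _ ≤ (L + L) * Real.log (Fintype.card α) := by
          gcongr
          exact_mod_cast hL
      _ = 2 * Real.log (Fintype.card α) * L := by ring

theorem exists_sqrt_mul_log_le_length (hn : 2 ≤ n)
    {code : Matrix (Fin n) (Fin n) (Fin 3) → List Bool}
    (hcode : Set.InjOn code (sparseRowMatrices n)) :
    ∃ W ∈ sparseRowMatrices n,
      1 / 16 * (Real.sqrt n * Real.log n) ≤ ((code W).length : ℝ) := by
  have hF : (sparseRowMatrices n).Nonempty := ⟨_, ∅, fun _ hx => hx.elim, rfl⟩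
  obtain ⟨W, hW, hlen⟩ :=
    exists_log_ncard_le_length Fintype.card_bool.ge (Set.toFinite _) hF hcode
  refine ⟨W, hW, ?_⟩
  rw [Fintype.card_bool, Nat.cast_ofNat] at hlen
  have hlog2 : 2 * Real.log 2 * (code W).length ≤ 2 * 1 * (code W).length := by
    gcongr
    linarith [Real.log_two_lt_d9]
  linarith [sqrt_mul_log_le_log_ncard_sparseRowMatrices hn]

end Codes

end TwoDBlockTree

theorem mainTheorem4 :
    -- uniform space bound, in words
    (∀ k : ℕ, 2 ≤ k → ∀ w : ℕ → ℕ, TwoDBlockTree.IsWordSize w →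
      ∃ C : ℝ, 0 < C ∧ ∀ (S : Type u) (n : ℕ) (M : Matrix (Fin n) (Fin n) S), 1 ≤ n →
        (TwoDBlockTree.spaceWords M k (w n) : ℝ) ≤
          C * ((TwoDBlockTree.delta2D M + Real.sqrt (n * TwoDBlockTree.delta2D M)) *
            (1 + Real.log (n / Real.sqrt (TwoDBlockTree.delta2D M))))) ∧
    -- the same with `log (n / δ)`, for `δ` polynomially smaller than `n`
    (∀ k : ℕ, 2 ≤ k → ∀ w : ℕ → ℕ, TwoDBlockTree.IsWordSize w → ∀ ε : ℝ, 0 < ε →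
      ∃ C : ℝ, 0 < C ∧ ∀ (S : Type u) (n : ℕ) (M : Matrix (Fin n) (Fin n) S), 2 ≤ n →
        TwoDBlockTree.delta2D M ≤ (n : ℝ) ^ (1 - ε) →
        (TwoDBlockTree.spaceWords M k (w n) : ℝ) ≤
          C * ((TwoDBlockTree.delta2D M + Real.sqrt (n * TwoDBlockTree.delta2D M)) *
            Real.log (n / TwoDBlockTree.delta2D M))) ∧
    -- optimality up to a factor `O(log n)`
    (∃ (D c : ℝ) (F : ∀ n : ℕ, Set (Matrix (Fin n) (Fin n) (Fin 3))), 0 < c ∧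
      (∀ n : ℕ, ∀ M ∈ F n, TwoDBlockTree.delta2D M ≤ D) ∧
      (∀ n : ℕ, 2 ≤ n → ∀ code : Matrix (Fin n) (Fin n) (Fin 3) → List Bool,
        Set.InjOn code (F n) →
          ∃ W ∈ F n, c * (Real.sqrt n * Real.log n) ≤ ((code W).length : ℝ)) ∧
      (∀ k : ℕ, 2 ≤ k → ∀ w : ℕ → ℕ, TwoDBlockTree.IsWordSize w →
        ∃ C : ℝ, 0 < C ∧ ∀ n : ℕ, 2 ≤ n →
          (∀ M ∈ F n, ((TwoDBlockTree.spaceWords M k (w n) * w n : ℕ) : ℝ) ≤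
            C * (Real.sqrt n * Real.log n ^ 2)) ∧
          (∀ code : Matrix (Fin n) (Fin n) (Fin 3) → List Bool, Set.InjOn code (F n) →
            ∃ W ∈ F n, ∀ M ∈ F n,
              ((TwoDBlockTree.spaceWords M k (w n) * w n : ℕ) : ℝ) ≤
                C * Real.log n * ((code W).length : ℝ)))) := by
  refine ⟨fun k hk w hw => ?_, fun k hk w hw ε hε => ?_, 2, 1 / 16,
    TwoDBlockTree.sparseRowMatrices, by norm_num,
    fun n M => TwoDBlockTree.delta2D_le_two_of_mem_sparseRowMatrices,
    fun n hn code => TwoDBlockTree.exists_sqrt_mul_log_le_length hn, fun k hk w hw => ?_⟩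
  · exact ⟨TwoDBlockTree.spaceConstant k, TwoDBlockTree.spaceConstant_pos k,
      fun S n M hn => TwoDBlockTree.spaceWords_le M hn hk (hw.1 n)⟩
  · exact ⟨TwoDBlockTree.spaceConstant k * (3 / ε),
      mul_pos (TwoDBlockTree.spaceConstant_pos k) (by positivity), fun S n M hn hδ =>
        TwoDBlockTree.spaceWords_le_of_delta2D_le_rpow M hn hk (hw.1 n) hε hδ⟩
  · obtain ⟨C, hC, hspace⟩ := hw.exists_spaceWords_mul_le hk zero_lt_two
    have hbits : ∀ n, 2 ≤ n → ∀ M ∈ TwoDBlockTree.sparseRowMatrices n,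
        ((TwoDBlockTree.spaceWords M k (w n) * w n : ℕ) : ℝ) ≤
          C * (Real.sqrt n * Real.log n ^ 2) := fun n hn M hM =>
      hspace (Fin 3) n M hn (TwoDBlockTree.delta2D_le_two_of_mem_sparseRowMatrices hM)
    refine ⟨16 * C, by positivity, fun n hn => ⟨fun M hM => (hbits n hn M hM).trans ?_,
      fun code hcode => ?_⟩⟩
    · gcongr
      linarith
    · obtain ⟨W, hW, hlen⟩ := TwoDBlockTree.exists_sqrt_mul_log_le_length hn hcode
      have hlog : 0 ≤ 16 * C * Real.log n :=
        mul_nonneg (by positivity) (Real.log_natCast_nonneg n)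
      exact ⟨W, hW, fun M hM => by linarith [hbits n hn M hM, mul_le_mul_of_nonneg_left hlen hlog]⟩
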